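/- Setting. Let $L_h\in\mathbb R^{m\times m}$ be symmetric positive definite, let $\langle u,v\rangle=v^Tu$, $\|v\|=\sqrt{\langle v,v\rangle}$, let $G_h:\mathbb R^m\to\mathbb R^m$ have non-negative entries, let $g_h:\mathbb R^m\to\mathbb R^m$ satisfy $g_h(v)=-\nabla_v\langle G_h(v),1\rangle$ for all $v$ and be Lipschitz continuous in $\|\cdot\|$ with constant $\ell_g>0$, and let $$E[v]=\tfrac12\langle v,L_hv\rangle+\langle G_h(v),1\rangle .$$ Let $\kappa\ge 2\ell_g$, $L_\kappa=L_h+\kappa I$, $g_\kappa(u)=g_h(u)+\kappa u$. Put $\varphi_0(z)=e^z$ and $\varphi_j(z)=\int_0^1e^{(1-s)z}\frac{s^{j-1}}{(j-1)!}\,ds$ for $j\ge1$. Method. For abscissas $c_2,c_3$ let $\gamma=\frac{(3c_3-2)c_3}{(2-3c_2)c_2}$. The two-parameter three-stage method EERK3-2 has the coefficients $$a_{21}(z)=c_2\varphi_1(c_2z),\quad a_{32}(z)=\gamma c_2\varphi_2(c_2z)+\tfrac{c_3^2}{c_2}\varphi_2(c_3z),\quad a_{31}(z)=c_3\varphi_1(c_3z)-a_{32}(z),$$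 $$a_{42}(z)=\tfrac{\gamma}{\gamma c_2+c_3}\varphi_2(z),\quad a_{43}(z)=\tfrac{1}{\gamma c_2+c_3}\varphi_2(z),\quad a_{41}(z)=\varphi_1(z)-a_{42}(z)-a_{43}(z).$$ The $n$-th step, with step size $\tau=\tau_n>0$, takes $u_h^{n-1}$ to $u_h^n$ by $U^{n,1}=u_h^{n-1}$, $$U^{n,i+1}=U^{n,1}+\sum_{j=1}^{i}a_{i+1,j}(-\tau L_\kappa)\left[\tau g_\kappa(U^{n,j})-\tau L_\kappa U^{n,1}\right]\quad(1\le i\le 3),\qquad u_h^n=U^{n,4}.$$ Differentiation matrix. Let $\underline a_{i+1,i}=a_{i+1,i}$ and $\underline a_{i+1,j}=a_{i+1,j}-a_{i,j}$ for $j<i$; let $\theta_{kk}=1/\underline a_{k+1,k}$ and $\theta_{kj}=-\sum_{\ell=j+1}^{k}\theta_{k\ell}\,\underline a_{\ell+1,j}/\underline a_{j+1,j}$ for $1\le j<k$; and let $D^{(3,2)}(c_2,c_3,z)=(d^{(3,2)}_{k\ell}(c_2,c_3,z))_{3\times3}$ with $d^{(3,2)}_{k\ell}=\theta_{k\ell}(z)+\frac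 z2(2-\delta_{k\ell})$ for $\ell\le k$ and $d^{(3,2)}_{k\ell}=0$ for $\ell>k$. Write $\delta_\tau U^{n,k+1}=U^{n,k+1}-U^{n,k}$. Claim. Let $c_2=1$ and $c_3=\frac12$. (a) The symmetric part $\frac12\left[D^{(3,2)}(1,\tfrac12,z)+D^{(3,2)}(1,\tfrac12,z)^T\right]$ is positive definite for every $z<0$. (b) The method preserves the energy dissipation law unconditionally (that is, for arbitrary step sizes $\tau=\tau_n>0$) at all stages: for every step $n\ge1$ and every $1\le j\le3$, $$E[U^{n,j+1}]-E[U^{n,1}]\le-\frac1\tau\sum_{k=1}^{j}\Big\langle\delta_\tau U^{n,k+1},\sum_{\ell=1}^{k}d^{(3,2)}_{k\ell}(1,\tfrac12,-\tau L_\kappa)\,\delta_\tau U^{n,\ell+1}\Big\rangle\le 0 .$$ In particular $E[U^{n,j+1}]\le E[U^{n,1}]$ for $1\le j\le3$, and $E[u_h^n]\le E[u_h^{n-1}]$. -/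

import Mathlib

noncomputable section

namespace EERK

/-- The entire functions `φ_j`, on the real line: `φ_0(z) = e^z` and
`φ_j(z) = ∫_0^1 e^{(1-s)z} s^{j-1}/(j-1)! ds` for `j ≥ 1`. -/
def phi : ℕ → ℝ → ℝ
  | 0, z => Real.exp z
  | j + 1, z => ∫ s in (0 : ℝ)..1, Real.exp ((1 - s) * z) * s ^ j / (Nat.factorial j : ℝ)

/-- The parameter `γ = (3c₃ - 2)c₃ / ((2 - 3c₂)c₂)` of the two-parameter family EERK3-2. -/
def gam (c₂ c₃ : ℝ) : ℝ := (3 * c₃ - 2) * c₃ / ((2 - 3 * c₂) * c₂)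

/-- The coefficients `a_{ij}(z)` (indices starting at 1) of the three-stage method EERK3-2 with
abscissas `c₂`, `c₃`; the row `i = 4` holds the weights, `a_{4j} = b_j`. -/
def coeff32 (c₂ c₃ : ℝ) : ℕ → ℕ → ℝ → ℝ
  | 2, 1, z => c₂ * phi 1 (c₂ * z)
  | 3, 1, z => c₃ * phi 1 (c₃ * z)
      - (gam c₂ c₃ * c₂ * phi 2 (c₂ * z) + c₃ ^ 2 / c₂ * phi 2 (c₃ * z))
  | 3, 2, z => gam c₂ c₃ * c₂ * phi 2 (c₂ * z) + c₃ ^ 2 / c₂ * phi 2 (c₃ * z)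
  | 4, 1, z => phi 1 z - gam c₂ c₃ / (gam c₂ c₃ * c₂ + c₃) * phi 2 z
      - 1 / (gam c₂ c₃ * c₂ + c₃) * phi 2 z
  | 4, 2, z => gam c₂ c₃ / (gam c₂ c₃ * c₂ + c₃) * phi 2 z
  | 4, 3, z => 1 / (gam c₂ c₃ * c₂ + c₃) * phi 2 z
  | _, _, _ => 0

/-- Difference coefficients: `a̲_{i+1,i} = a_{i+1,i}` and `a̲_{i+1,j} = a_{i+1,j} - a_{i,j}` for
`j < i`. The first index of `diffCoeff` is the row `i + 1`. -/
def diffCoeff (a : ℕ → ℕ → ℝ → ℝ) (row j : ℕ) (z : ℝ) : ℝ :=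
  if row = j + 1 then a row j z else a row j z - a (row - 1) j z

/-- The discrete orthogonal convolution kernels `θ_{kj}(z)`, `1 ≤ j ≤ k`:
`θ_{kk} = 1 / a̲_{k+1,k}` and `θ_{kj} = -∑_{ℓ=j+1}^{k} θ_{kℓ} a̲_{ℓ+1,j} / a̲_{j+1,j}` for `j < k`. -/
def docKernel (a : ℕ → ℕ → ℝ → ℝ) (k j : ℕ) (z : ℝ) : ℝ :=
  if j < k then
    -∑ l : {l : ℕ // l ∈ Finset.Icc (j + 1) k},
      docKernel a k l.1 z * (diffCoeff a (l.1 + 1) j z / diffCoeff a (j + 1) j z)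
  else if j = k then 1 / diffCoeff a (k + 1) k z
  else 0
termination_by k - j
decreasing_by
  have h := Finset.mem_Icc.mp l.2
  omega

/-- The entries `d_{kℓ}(z)` of the differentiation matrix (indices starting at 1):
`θ_{kℓ}(z) + (z/2)(2 - δ_{kℓ})` for `ℓ ≤ k`, and `0` for `ℓ > k`. -/
def diffEntry (a : ℕ → ℕ → ℝ → ℝ) (k l : ℕ) (z : ℝ) : ℝ :=
  if l ≤ k then docKernel a k l z + z / 2 * (2 - if k = l then 1 else 0) else 0

/-- The differentiation matrix `D(z) = (d_{kℓ}(z))` of size `s × s`. -/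
def diffMatrix (s : ℕ) (a : ℕ → ℕ → ℝ → ℝ) (z : ℝ) : Matrix (Fin s) (Fin s) ℝ :=
  Matrix.of fun k l => diffEntry a (k.1 + 1) (l.1 + 1) z

/-- The symmetric part `(D + Dᵀ) / 2`. -/
def symPart {s : ℕ} (D : Matrix (Fin s) (Fin s) ℝ) : Matrix (Fin s) (Fin s) ℝ :=
  (1 / 2 : ℝ) • (D + D.transpose)

variable {ι : Type*} [Fintype ι] [DecidableEq ι]

/-- The stabilized matrix `L_κ = L_h + κ I`. -/
def Lstab (L : Matrix ι ι ℝ) (κ : ℝ) : Matrix ι ι ℝ := L + κ • (1 : Matrix ι ι ℝ)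

/-- The stabilized nonlinearity `g_κ(u) = g_h(u) + κ u`. -/
def gstab (g : EuclideanSpace ℝ ι → EuclideanSpace ℝ ι) (κ : ℝ) (u : EuclideanSpace ℝ ι) :
    EuclideanSpace ℝ ι := g u + κ • u

/-- `f(-τ L_κ) v`: the matrix function `f(-τ L_κ)` of a symmetric matrix (the function `f` applied
to the eigenvalues, Mathlib's functional calculus) applied to the vector `v`. -/
def applyFun (f : ℝ → ℝ) (L : Matrix ι ι ℝ) (κ τ : ℝ) (v : EuclideanSpace ℝ ι) :
    EuclideanSpace ℝ ι :=
  Matrix.toEuclideanLin (cfc f (-(τ • Lstab L κ))) v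

/-- The energy `E[v] = ½⟨v, L_h v⟩ + ⟨G_h(v), 1⟩`. -/
def energy (L : Matrix ι ι ℝ) (G : EuclideanSpace ℝ ι → EuclideanSpace ℝ ι)
    (v : EuclideanSpace ℝ ι) : ℝ :=
  1 / 2 * inner ℝ v (Matrix.toEuclideanLin L v) + ∑ i, G v i

/-- One step, from `v` to `w` with step size `τ`, of the `s`-stage explicit exponential Runge-Kutta
method with coefficients `a_{ij}`, applied to the stabilized problem `u' = -L_κ u + g_κ(u)`;
`U 1, …, U (s+1)` are the stage values. -/
def IsStep (s : ℕ) (a : ℕ → ℕ → ℝ → ℝ) (L : Matrix ι ι ℝ)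
    (g : EuclideanSpace ℝ ι → EuclideanSpace ℝ ι) (κ τ : ℝ)
    (v : EuclideanSpace ℝ ι) (U : ℕ → EuclideanSpace ℝ ι) (w : EuclideanSpace ℝ ι) : Prop :=
  U 1 = v ∧
  (∀ i ∈ Finset.Icc 1 s, U (i + 1) = U 1 + ∑ j ∈ Finset.Icc 1 i,
    applyFun (a (i + 1) j) L κ τ
      (τ • gstab g κ (U j) - τ • Matrix.toEuclideanLin (Lstab L κ) (U 1))) ∧
  w = U (s + 1)

/-- The sum `∑_{k=1}^{j} ⟨δ_τU^{k+1}, ∑_{ℓ=1}^{k} d_{kℓ}(-τ L_κ) δ_τU^{ℓ+1}⟩`, where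
`δ_τU^{k+1} = U^{k+1} - U^k`. -/
def dissipation (a : ℕ → ℕ → ℝ → ℝ) (L : Matrix ι ι ℝ) (κ τ : ℝ)
    (U : ℕ → EuclideanSpace ℝ ι) (j : ℕ) : ℝ :=
  ∑ k ∈ Finset.Icc 1 j, inner ℝ (U (k + 1) - U k)
    (∑ l ∈ Finset.Icc 1 k, applyFun (diffEntry a k l) L κ τ (U (l + 1) - U l))

end EERK

end

/-!
The stage equations express the stage differences `δ_τU^{k+1}` through the forcings
`F_j = τ g_κ(U^j) - τ L_κ U^1` by the lower triangular matrix `A` of difference coefficients. The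
kernels `θ` form `A⁻¹`, so the matrix `D` acts on the stage differences as
`∑_ℓ d_{kℓ}(-τ L_κ) δ_τU^{ℓ+1} = τ (g_κ(U^k) - L_κ (U^{k+1} + U^k) / 2)`
(`sum_diffEntry_mul_stage_diff` for scalars, `IsStep.sum_applyFun_diffEntry` for vectors, by passing
to an eigenbasis of `-τ L_κ`). Tested with `δ_τU^{k+1}`, the right-hand side is at most `-τ` times the
energy increment because `κ ≥ 2 ℓ_g` (`energy_sub_le`); summing over the stages gives the
dissipation law. In the eigenbasis the dissipation is a sum of values of the quadratic form of `D(z)`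
at the eigenvalues `z < 0`, so it is nonnegative once `D(z)` has a positive definite symmetric part.

For the positive definiteness (`lowerQuad_pos`), the congruence `D ↦ A D Aᵀ` removes the inverse:
the symmetric part of `A D Aᵀ` is `(A + Aᵀ) / 2 + (z / 2) σ σᵀ`, with `σ` the row sums of `A`. At
`z = -2 t` the entries, in the basis `e₁, e₂ + e₃, e₃` and multiplied by `8 t ^ 2`, are polynomials in
`t` and `h = exp (-t)`. Sylvester's criterion leaves two inequalities. The determinant
(`det_reducedForm_pos`), multiplied by `exp (8 t)`, is an exponential polynomial all of whose Taylor
coefficients at `0` are nonnegative, which is a statement about integers that is proved by Abel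
summation (`detCoeff_taylor_nonneg`).
-/

noncomputable section

namespace EERK

/-! ### Positivity of exponential polynomials -/

theorem hasSum_pow_mul_exp (a : ℕ) (k t : ℝ) :
    HasSum (fun n : ℕ => (n.descFactorial a : ℝ) * k ^ (n - a) * (t ^ n / n.factorial))
      (t ^ a * Real.exp (k * t)) := by
  -- The terms with `n < a` vanish, and the others form the exponential series shifted by `a`.
  rw [← hasSum_nat_add_iff' a]
  have hzero : ∑ n ∈ Finset.range a,
      (n.descFactorial a : ℝ) * k ^ (n - a) * (t ^ n / n.factorial) = 0 :=
    Finset.sum_eq_zero fun n hn => by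
      rw [Nat.descFactorial_eq_zero_iff_lt.mpr (Finset.mem_range.mp hn)]; simp
  rw [hzero, sub_zero, Real.exp_eq_exp_ℝ]
  have hexp := (NormedSpace.exp_series_hasSum_exp' (𝕂 := ℝ) (k * t)).mul_left (t ^ a)
  suffices hfun : ∀ n : ℕ, ((n + a).descFactorial a : ℝ) * k ^ (n + a - a) *
      (t ^ (n + a) / (n + a).factorial) = t ^ a * ((n.factorial : ℝ)⁻¹ • (k * t) ^ n) by
    simpa only [hfun] using hexp
  intro n
  have hfac : (n.factorial : ℝ) * ((n + a).descFactorial a : ℝ) = ((n + a).factorial : ℝ) := by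
    have := Nat.factorial_mul_descFactorial (Nat.le_add_left a n)
    rw [Nat.add_sub_cancel] at this
    exact_mod_cast this
  have h1 : ((n + a).factorial : ℝ) ≠ 0 := by positivity
  have h2 : (n.factorial : ℝ) ≠ 0 := by positivity
  rw [Nat.add_sub_cancel, smul_eq_mul]
  field_simp
  rw [← hfac]
  ring

/-- An exponential polynomial `∑ C k a * t ^ a * exp (k t)` with natural exponents is positive for
`t > 0` as soon as its Taylor coefficients at `0` (times `n!`, hence integers) are nonnegative and
one of them is positive. -/
theorem expPoly_pos {p q : ℕ} (C : Fin p → Fin q → ℤ)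
    (hC : ∀ n : ℕ, 0 ≤ ∑ k, ∑ a, C k a * (n.descFactorial a * (k : ℤ) ^ (n - a)))
    (n₀ : ℕ) (hn₀ : 0 < ∑ k, ∑ a, C k a * (n₀.descFactorial a * (k : ℤ) ^ (n₀ - a)))
    {t : ℝ} (ht : 0 < t) :
    0 < ∑ k, ∑ a, (C k a : ℝ) * (t ^ (a : ℕ) * Real.exp ((k : ℕ) * t)) := by
  have hsum : HasSum
      (fun n : ℕ => ∑ k, ∑ a, (C k a : ℝ) *
        ((n.descFactorial a : ℝ) * ((k : ℕ) : ℝ) ^ (n - a) * (t ^ n / n.factorial)))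
      (∑ k, ∑ a, (C k a : ℝ) * (t ^ (a : ℕ) * Real.exp ((k : ℕ) * t))) :=
    hasSum_sum fun k _ => hasSum_sum fun a _ => (hasSum_pow_mul_exp a k t).mul_left _
  have hterm (n : ℕ) : ∑ k, ∑ a, (C k a : ℝ) *
        ((n.descFactorial a : ℝ) * ((k : ℕ) : ℝ) ^ (n - a) * (t ^ n / n.factorial)) =
      ((∑ k, ∑ a, C k a * (n.descFactorial a * (k : ℤ) ^ (n - a)) : ℤ) : ℝ) *
        (t ^ n / n.factorial) := by
    push_cast
    simp_rw [Finset.sum_mul, mul_assoc]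
  simp_rw [hterm] at hsum
  refine lt_of_lt_of_le ?_ (sum_le_hasSum {n₀} (fun n _ => ?_) hsum)
  · rw [Finset.sum_singleton]
    exact mul_pos (by exact_mod_cast hn₀) (by positivity)
  · exact mul_nonneg (by exact_mod_cast hC n) (by positivity)

/-- Abel summation: weights whose tail sums are all nonnegative have a nonnegative pairing with
any nonnegative increasing sequence. -/
theorem sum_mul_nonneg_of_tail_sum_nonneg {n : ℕ} (p : Fin (n + 1) → ℤ) {x : Fin (n + 1) → ℤ}
    (hx : Monotone x) (hx0 : 0 ≤ x 0) (hp : ∀ j, 0 ≤ ∑ k, if j ≤ k then p k else 0) :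
    0 ≤ ∑ k, p k * x k := by
  suffices h : x 0 * ∑ k, p k ≤ ∑ k, p k * x k from
    (mul_nonneg hx0 (by simpa using hp 0)).trans h
  clear hx0
  induction n with
  | zero => simp [mul_comm]
  | succ n ih =>
    have htail (j : Fin (n + 1)) : 0 ≤ ∑ k : Fin (n + 1), if j ≤ k then p k.succ else 0 := by
      simpa [Fin.sum_univ_succ (n := n + 1)] using hp j.succ
    have h1 := ih (fun k => p k.succ) (hx.comp (Fin.strictMono_succ).monotone) htail
    have h2 : x 0 ≤ x (Fin.succ 0) := hx (Fin.zero_le _)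
    have h3 : 0 ≤ ∑ k : Fin (n + 1), p k.succ := by simpa using htail 0
    rw [Fin.sum_univ_succ, Fin.sum_univ_succ (fun k => p k * x k)]
    dsimp only [Function.comp] at h1
    nlinarith [mul_le_mul_of_nonneg_right h2 h3]

/-- Coefficients of the determinant in `det_reducedForm_pos`, multiplied by `144 * exp (8 * t)`: the
entry `(k, a)` is the coefficient of `t ^ a * exp (k * t)`. -/
def detCoeff : Fin 9 → Fin 4 → ℤ :=
  ![![0, 338, 0, 0], ![0, -2144, 0, 0], ![-160, 76, -1192, 0], ![-640, 4048, -3872, 0],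
    ![1120, -1856, 1224, -3448], ![1280, -3456, 5120, -320], ![-1760, 3924, -2648, -640],
    ![-640, 1552, 32, 0], ![800, -2482, 1336, 568]]

/-- The first nine Taylor coefficients are checked directly; from `n = 9` on, the tail sums of the
polynomial factors of `8 ^ n, 7 ^ n, …` are already nonnegative, so Abel summation applies. -/
theorem detCoeff_taylor_nonneg (n : ℕ) :
    0 ≤ ∑ k, ∑ a, detCoeff k a * (n.descFactorial a * (k : ℤ) ^ (n - a)) := by
  rcases lt_or_ge n 9 with hn | hn
  · interval_cases n <;> decide
  · obtain ⟨m, rfl⟩ := Nat.exists_eq_add_of_le' hn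
    have hsplit : ∑ k, ∑ a, detCoeff k a * ((m + 9).descFactorial a * (k : ℤ) ^ (m + 9 - a)) =
        ∑ k, (∑ a, detCoeff k a * ((m + 9).descFactorial a * (k : ℤ) ^ (9 - (a : ℕ)))) *
          (k : ℤ) ^ m := by
      simp_rw [Finset.sum_mul]
      refine Finset.sum_congr rfl fun k _ => Finset.sum_congr rfl fun a _ => ?_
      rw [show m + 9 - (a : ℕ) = (9 - a) + m by omega, pow_add]
      ring
    rw [hsplit]
    refine sum_mul_nonneg_of_tail_sum_nonneg _ (fun i j hij => ?_) (by positivity) fun j => ?_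
    · exact pow_le_pow_left₀ (by positivity) (by exact_mod_cast hij) m
    · have hm : (0 : ℤ) ≤ m := by positivity
      have hm2 : (0 : ℤ) ≤ (m : ℤ) ^ 2 := by positivity
      have hm3 : (0 : ℤ) ≤ (m : ℤ) ^ 3 := by positivity
      fin_cases j <;>
      · simp [Fin.sum_univ_succ, detCoeff, Nat.descFactorial_succ]
        ring_nf
        linarith

/-! ### Closed forms of the phi functions -/

theorem phi_one_eq {z : ℝ} (hz : z ≠ 0) : phi 1 z = (Real.exp z - 1) / z := by
  have hderiv : ∀ s ∈ Set.uIcc (0 : ℝ) 1, HasDerivAt (fun s => -Real.exp ((1 - s) * z) / z)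
      (Real.exp ((1 - s) * z) * s ^ 0 / (Nat.factorial 0 : ℝ)) s := fun s _ => by
    have h := ((((hasDerivAt_id s).const_sub 1).mul_const z).exp.neg.div_const z)
    refine h.congr_deriv ?_
    simp only [id, Nat.factorial]
    field_simp
    simp
  rw [phi, intervalIntegral.integral_eq_sub_of_hasDerivAt hderiv
    ((by fun_prop : Continuous _).intervalIntegrable _ _)]
  simp
  field_simp
  ring

theorem phi_two_eq {z : ℝ} (hz : z ≠ 0) : phi 2 z = (Real.exp z - 1 - z) / z ^ 2 := by
  have hderiv : ∀ s ∈ Set.uIcc (0 : ℝ) 1,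
      HasDerivAt (fun s => -Real.exp ((1 - s) * z) * (s * z + 1) / z ^ 2)
      (Real.exp ((1 - s) * z) * s ^ 1 / (Nat.factorial 1 : ℝ)) s := fun s _ => by
    have h := ((((hasDerivAt_id s).const_sub 1).mul_const z).exp.neg.mul
      (((hasDerivAt_id s).mul_const z).add_const 1)).div_const (z ^ 2)
    refine h.congr_deriv ?_
    simp only [id, Nat.factorial]
    field_simp
    simp
    ring_nf
  rw [phi, intervalIntegral.integral_eq_sub_of_hasDerivAt hderiv
    ((by fun_prop : Continuous _).intervalIntegrable _ _)]
  simp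
  field_simp
  ring

/-! ### Discrete orthogonal convolution kernels -/

section Kernel

variable {a : ℕ → ℕ → ℝ → ℝ} {z : ℝ}

theorem docKernel_self (a : ℕ → ℕ → ℝ → ℝ) (k : ℕ) (z : ℝ) :
    docKernel a k k z = 1 / diffCoeff a (k + 1) k z := by
  rw [docKernel, if_neg (lt_irrefl k), if_pos rfl]

/-- Discrete orthogonality: the kernels `θ` form the inverse of the lower triangular matrix of
difference coefficients. -/
theorem sum_docKernel_mul_diffCoeff {k j : ℕ} (hjk : j ≤ k)
    (hj : diffCoeff a (j + 1) j z ≠ 0) :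
    ∑ l ∈ Finset.Icc j k, docKernel a k l z * diffCoeff a (l + 1) j z =
      if j = k then 1 else 0 := by
  rcases hjk.eq_or_lt with rfl | hlt
  · simp [docKernel_self, hj]
  · rw [if_neg hlt.ne, ← Finset.add_sum_Ioc_eq_sum_Icc hjk, docKernel, if_pos hlt,
      Finset.sum_coe_sort (Finset.Icc (j + 1) k)
        fun l => docKernel a k l z * (diffCoeff a (l + 1) j z / diffCoeff a (j + 1) j z),
      neg_mul, Finset.sum_mul]
    have hIoc : Finset.Icc (j + 1) k = Finset.Ioc j k := by
      ext l; simp only [Finset.mem_Icc, Finset.mem_Ioc]; omega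
    rw [hIoc, neg_add_eq_zero]
    exact Finset.sum_congr rfl fun l _ => by field_simp

theorem sum_docKernel_mul_sum_diffCoeff {k : ℕ} (hk : 1 ≤ k)
    (ha : ∀ j ∈ Finset.Icc 1 k, diffCoeff a (j + 1) j z ≠ 0) (F : ℕ → ℝ) :
    ∑ l ∈ Finset.Icc 1 k, docKernel a k l z *
      ∑ j ∈ Finset.Icc 1 l, diffCoeff a (l + 1) j z * F j = F k := by
  simp_rw [Finset.mul_sum]
  rw [Finset.sum_comm' (t' := Finset.Icc 1 k) (s' := fun j => Finset.Icc j k)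
    (by intro l j; simp only [Finset.mem_Icc]; omega)]
  have hinner (j) (hj : j ∈ Finset.Icc 1 k) :
      ∑ l ∈ Finset.Icc j k, docKernel a k l z * (diffCoeff a (l + 1) j z * F j) =
        if j = k then F j else 0 := by
    simp_rw [← mul_assoc]
    rw [← Finset.sum_mul, sum_docKernel_mul_diffCoeff (Finset.mem_Icc.mp hj).2 (ha j hj)]
    split_ifs <;> simp
  rw [Finset.sum_congr rfl hinner, Finset.sum_ite_eq' _ k, if_pos (by simp [hk])]

theorem stage_diff_eq_sum {s : ℕ} {x F : ℕ → ℝ}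
    (hx : ∀ i ∈ Finset.Icc 1 s, x (i + 1) = x 1 + ∑ j ∈ Finset.Icc 1 i, a (i + 1) j z * F j)
    {l : ℕ} (hl : l ∈ Finset.Icc 1 s) :
    x (l + 1) - x l = ∑ j ∈ Finset.Icc 1 l, diffCoeff a (l + 1) j z * F j := by
  obtain ⟨h1, hs⟩ := Finset.mem_Icc.mp hl
  obtain ⟨i, rfl⟩ := Nat.exists_eq_add_of_le' h1
  rw [hx _ hl, Finset.sum_Icc_succ_top h1, Finset.sum_Icc_succ_top h1]
  have hlast : diffCoeff a (i + 1 + 1) (i + 1) z = a (i + 1 + 1) (i + 1) z := by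
    simp [diffCoeff]
  have hlower : ∑ j ∈ Finset.Icc 1 i, diffCoeff a (i + 1 + 1) j z * F j =
      ∑ j ∈ Finset.Icc 1 i, a (i + 1 + 1) j z * F j -
        ∑ j ∈ Finset.Icc 1 i, a (i + 1) j z * F j := by
    rw [← Finset.sum_sub_distrib]
    refine Finset.sum_congr rfl fun j hj => ?_
    have : ¬ i + 1 + 1 = j + 1 := by have := (Finset.mem_Icc.mp hj).2; omega
    rw [diffCoeff, if_neg this, Nat.add_sub_cancel, sub_mul]
  have hprev : x (i + 1) = x 1 + ∑ j ∈ Finset.Icc 1 i, a (i + 1) j z * F j := by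
    rcases Nat.eq_zero_or_pos i with rfl | hi
    · simp
    · exact hx i (Finset.mem_Icc.mpr ⟨hi, by omega⟩)
  rw [hlower, hlast, hprev]
  ring

/-- The purpose of the matrix `D`: applied to the stage differences it recovers the stage forcing
`F k`, and its summands `(z / 2) (2 - δ)` add the midpoint of two consecutive stages relative to
the first one. -/
theorem sum_diffEntry_mul_stage_diff {s : ℕ} {x F : ℕ → ℝ}
    (ha : ∀ j ∈ Finset.Icc 1 s, diffCoeff a (j + 1) j z ≠ 0)
    (hx : ∀ i ∈ Finset.Icc 1 s, x (i + 1) = x 1 + ∑ j ∈ Finset.Icc 1 i, a (i + 1) j z * F j)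
    {k : ℕ} (hk : k ∈ Finset.Icc 1 s) :
    ∑ l ∈ Finset.Icc 1 k, diffEntry a k l z * (x (l + 1) - x l) =
      F k + z * ((x (k + 1) + x k) / 2 - x 1) := by
  obtain ⟨h1, hs⟩ := Finset.mem_Icc.mp hk
  have hsub {l : ℕ} (hl : l ∈ Finset.Icc 1 k) : l ∈ Finset.Icc 1 s := by
    simp only [Finset.mem_Icc] at *; omega
  have hentry : ∀ l ∈ Finset.Icc 1 k, diffEntry a k l z * (x (l + 1) - x l) =
      docKernel a k l z * ∑ j ∈ Finset.Icc 1 l, diffCoeff a (l + 1) j z * F j +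
        (z * (x (l + 1) - x l) - if k = l then z / 2 * (x (l + 1) - x l) else 0) := by
    intro l hl
    rw [← stage_diff_eq_sum hx (hsub hl), diffEntry, if_pos (Finset.mem_Icc.mp hl).2]
    split_ifs <;> ring
  have htel : ∑ l ∈ Finset.Icc 1 k, (x (l + 1) - x l) = x (k + 1) - x 1 := by
    rw [← Finset.Ico_add_one_right_eq_Icc, Finset.sum_Ico_sub x (by omega)]
  rw [Finset.sum_congr rfl hentry, Finset.sum_add_distrib,
    sum_docKernel_mul_sum_diffCoeff h1 (fun j hj => ha j (hsub hj)), Finset.sum_sub_distrib,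
    ← Finset.mul_sum, htel, Finset.sum_ite_eq, if_pos (Finset.mem_Icc.mpr ⟨h1, le_rfl⟩)]
  ring

end Kernel

/-! ### Positivity of the reduced ternary form -/

/-- Sylvester's criterion for a ternary quadratic form, by completing squares. -/
theorem ternary_quadratic_pos {m₁₁ m₁₂ m₁₃ m₂₂ m₂₃ m₃₃ : ℝ} (h₁ : 0 < m₁₁)
    (h₂ : 0 < m₁₁ * m₂₂ - m₁₂ ^ 2)
    (h₃ : 0 < m₁₁ * (m₂₂ * m₃₃ - m₂₃ ^ 2) - m₁₂ * (m₁₂ * m₃₃ - m₂₃ * m₁₃) +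
      m₁₃ * (m₁₂ * m₂₃ - m₂₂ * m₁₃))
    {x y u : ℝ} (hne : x ≠ 0 ∨ y ≠ 0 ∨ u ≠ 0) :
    0 < m₁₁ * x ^ 2 + m₂₂ * y ^ 2 + m₃₃ * u ^ 2 + 2 * m₁₂ * x * y + 2 * m₁₃ * x * u +
      2 * m₂₃ * y * u := by
  set Δ₂ := m₁₁ * m₂₂ - m₁₂ ^ 2 with hΔ₂
  set Δ₃ := m₁₁ * (m₂₂ * m₃₃ - m₂₃ ^ 2) - m₁₂ * (m₁₂ * m₃₃ - m₂₃ * m₁₃) +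
      m₁₃ * (m₁₂ * m₂₃ - m₂₂ * m₁₃) with hΔ₃
  set q := m₁₁ * x ^ 2 + m₂₂ * y ^ 2 + m₃₃ * u ^ 2 + 2 * m₁₂ * x * y + 2 * m₁₃ * x * u +
      2 * m₂₃ * y * u with hq
  have hsq : m₁₁ * Δ₂ * q = Δ₂ * (m₁₁ * x + m₁₂ * y + m₁₃ * u) ^ 2 +
      (Δ₂ * y + (m₁₁ * m₂₃ - m₁₂ * m₁₃) * u) ^ 2 + m₁₁ * Δ₃ * u ^ 2 := by
    rw [hΔ₂, hΔ₃, hq]; ring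
  refine pos_of_mul_pos_right (a := m₁₁ * Δ₂) ?_ (by positivity)
  rw [hsq]
  by_cases hu : u = 0
  · by_cases hy : y = 0
    · have hx : x ≠ 0 := by tauto
      subst hu hy
      have := h₁.ne'
      simp only [mul_zero, add_zero]
      positivity
    · subst hu
      have : 0 < (Δ₂ * y + (m₁₁ * m₂₃ - m₁₂ * m₁₃) * 0) ^ 2 := by
        simp only [mul_zero, add_zero]
        have := h₂.ne'
        positivity
      positivity
  · positivity

/-- The second leading minor is `5 / 9 * (2 t - 1 + h ^ 2)` times
`2 t + 5 - 5 h ^ 2 - 12 t h ^ 4`, and both factors are positive because `exp` lies above its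
tangent at `0`. -/
theorem minor_reducedForm_pos {t : ℝ} (ht : 0 < t) {h : ℝ} (hh : h = Real.exp (-t)) :
    0 < 2 * t * (1 - h ^ 4) * (10 / 3 * (2 * t - 1 + h ^ 2)) -
      (-(5 / 3) * (2 * t - 1 + h ^ 2)) ^ 2 := by
  have hh0 : 0 < h := hh ▸ Real.exp_pos _
  have hP : 0 < 2 * t - 1 + h ^ 2 := by
    have h2 : h ^ 2 = Real.exp (-(2 * t)) := by
      rw [hh, ← Real.exp_nat_mul]; congr 1; push_cast; ring
    have := Real.add_one_lt_exp (x := -(2 * t)) (by linarith)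
    linarith
  -- With `y = exp (2 * t) = h⁻²`, the second factor times `y ^ 2` is increasing in `y`, and it is
  -- positive at the lower bound `y = 1 + 2 * t`.
  set y := Real.exp (2 * t) with hy
  have hhy : h ^ 2 * y = 1 := by
    rw [hh, hy, ← Real.exp_nat_mul, ← Real.exp_add]; simp
  have hy1 : 2 * t + 1 < y := Real.add_one_lt_exp (by linarith)
  have hnum : 0 < (2 * t + 5) * y ^ 2 - 5 * y - 12 * t := by
    nlinarith [mul_pos ht ht, mul_pos (mul_pos ht ht) (sub_pos.mpr hy1)]
  have hfac : 0 < 2 * t + 5 - 5 * h ^ 2 - 12 * t * h ^ 4 := by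
    have : 2 * t + 5 - 5 * h ^ 2 - 12 * t * h ^ 4 =
        h ^ 4 * ((2 * t + 5) * y ^ 2 - 5 * y - 12 * t) := by
      linear_combination (-(2 * t + 5) * (h ^ 2 * y + 1) + 5 * h ^ 2) * hhy
    rw [this]; positivity
  have : 2 * t * (1 - h ^ 4) * (10 / 3 * (2 * t - 1 + h ^ 2)) -
      (-(5 / 3) * (2 * t - 1 + h ^ 2)) ^ 2 =
      5 / 9 * (2 * t - 1 + h ^ 2) * (2 * t + 5 - 5 * h ^ 2 - 12 * t * h ^ 4) := by ring
  rw [this]; positivity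

/-- The determinant has a zero of order six at `t = 0` and grows like `t ^ 3`; after multiplication
by `144 * exp (8 * t)` all its Taylor coefficients are nonnegative. -/
theorem det_reducedForm_pos {t : ℝ} (ht : 0 < t) {h m₁₁ m₁₂ m₁₃ m₂₂ m₂₃ m₃₃ : ℝ}
    (hh : h = Real.exp (-t))
    (h₁₁ : m₁₁ = 2 * t * (1 - h ^ 4)) (h₁₂ : m₁₂ = -(5 / 3) * (2 * t - 1 + h ^ 2))
    (h₂₂ : m₂₂ = 10 / 3 * (2 * t - 1 + h ^ 2))
    (h₁₃ : m₁₃ = 2 * t * h ^ 3 * (1 - h) - 17 / 12 * (2 * t - 1 + h ^ 2) + (t - 1 + h))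
    (h₂₃ : m₂₃ = (18 * t - 7 - 4 * h + 11 * h ^ 2) / 4)
    (h₃₃ : m₃₃ = 8 / 3 * (2 * t - 1 + h ^ 2) - 2 * t * h ^ 2 * (1 - h) ^ 2) :
    0 < m₁₁ * (m₂₂ * m₃₃ - m₂₃ ^ 2) - m₁₂ * (m₁₂ * m₃₃ - m₂₃ * m₁₃) +
      m₁₃ * (m₁₂ * m₂₃ - m₂₂ * m₁₃) := by
  have hh0 : 0 < h := hh ▸ Real.exp_pos _
  have hpos := expPoly_pos detCoeff detCoeff_taylor_nonneg 6 (by decide) ht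
  have hexp (k : ℕ) : Real.exp (k * t) = (h ^ k)⁻¹ := by
    rw [hh, ← Real.exp_nat_mul, ← Real.exp_neg]; congr 1; ring
  simp_rw [hexp] at hpos
  simp [Fin.sum_univ_succ, detCoeff] at hpos
  -- Both sides are compared after multiplication by `144 * exp (8 * t)`.
  refine pos_of_mul_pos_right (a := 144 * (h ^ 8)⁻¹) ?_ (by positivity)
  refine hpos.trans_eq ?_
  rw [h₁₁, h₁₂, h₂₂, h₁₃, h₂₃, h₃₃]
  field_simp
  ring

/-! ### The difference coefficients of EERK3-2 for `c₂ = 1`, `c₃ = 1 / 2` -/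

theorem gam_one_half : gam 1 (1 / 2) = 1 / 4 := by norm_num [gam]

/-- The difference coefficients for `c₂ = 1`, `c₃ = 1 / 2` at `z = -2 t`, as rational functions of
`t` and `h = exp (-t)`. -/
theorem diffCoeff_coeff32_values {t h : ℝ} (ht : 0 < t) (hh : h = Real.exp (-t)) :
    diffCoeff (coeff32 1 (1 / 2)) 2 1 (-(2 * t)) = (1 - h ^ 2) / (2 * t) ∧
    diffCoeff (coeff32 1 (1 / 2)) 3 2 (-(2 * t)) =
      ((2 * t - 1 + h ^ 2) / (4 * t ^ 2) + (t - 1 + h) / t ^ 2) / 4 ∧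
    diffCoeff (coeff32 1 (1 / 2)) 4 3 (-(2 * t)) = 4 / 3 * ((2 * t - 1 + h ^ 2) / (4 * t ^ 2)) ∧
    diffCoeff (coeff32 1 (1 / 2)) 3 1 (-(2 * t)) = (1 - h) / (2 * t) -
      ((2 * t - 1 + h ^ 2) / (4 * t ^ 2) + (t - 1 + h) / t ^ 2) / 4 - (1 - h ^ 2) / (2 * t) ∧
    diffCoeff (coeff32 1 (1 / 2)) 4 2 (-(2 * t)) = 1 / 3 * ((2 * t - 1 + h ^ 2) / (4 * t ^ 2)) -
      ((2 * t - 1 + h ^ 2) / (4 * t ^ 2) + (t - 1 + h) / t ^ 2) / 4 ∧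
    diffCoeff (coeff32 1 (1 / 2)) 4 1 (-(2 * t)) = (1 - h ^ 2) / (2 * t) -
      5 / 3 * ((2 * t - 1 + h ^ 2) / (4 * t ^ 2)) - ((1 - h) / (2 * t) -
      ((2 * t - 1 + h ^ 2) / (4 * t ^ 2) + (t - 1 + h) / t ^ 2) / 4) := by
  have he : Real.exp (-(2 * t)) = h ^ 2 := by
    rw [hh, ← Real.exp_nat_mul]; congr 1; push_cast; ring
  have hhalf : 1 / 2 * (-(2 * t)) = -t := by ring
  have p1 : phi 1 (-(2 * t)) = (1 - h ^ 2) / (2 * t) := by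
    rw [phi_one_eq (by linarith), he]; field_simp; ring
  have p1' : phi 1 (-t) = (1 - h) / t := by
    rw [phi_one_eq (by linarith), ← hh]; field_simp; ring
  have p2 : phi 2 (-(2 * t)) = (2 * t - 1 + h ^ 2) / (4 * t ^ 2) := by
    rw [phi_two_eq (by linarith), he]; field_simp; ring
  have p2' : phi 2 (-t) = (t - 1 + h) / t ^ 2 := by
    rw [phi_two_eq (by linarith), ← hh]; field_simp; ring
  refine ⟨?_, ?_, ?_, ?_, ?_, ?_⟩ <;>
    simp only [diffCoeff, coeff32, gam_one_half, hhalf, one_mul, p1, p1', p2, p2'] <;>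
    norm_num <;> ring

theorem diffCoeff_coeff32_diag_pos {z : ℝ} (hz : z < 0) :
    ∀ j ∈ Finset.Icc 1 3, 0 < diffCoeff (coeff32 1 (1 / 2)) (j + 1) j z := by
  obtain ⟨t, rfl⟩ : ∃ t, z = -(2 * t) := ⟨-z / 2, by ring⟩
  have ht : 0 < t := by linarith
  obtain ⟨e1, e2, e3, -⟩ := diffCoeff_coeff32_values ht rfl
  have hh1 : Real.exp (-t) < 1 := Real.exp_lt_one_iff.mpr (by linarith)
  have hh0 := Real.exp_pos (-t)
  have h1 := Real.add_one_lt_exp (x := -t) (by linarith)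
  have h2 := Real.add_one_lt_exp (x := -(2 * t)) (by linarith)
  have he : Real.exp (-(2 * t)) = Real.exp (-t) ^ 2 := by
    rw [← Real.exp_nat_mul]; congr 1; push_cast; ring
  have a1 : 0 < 1 - Real.exp (-t) ^ 2 := by nlinarith
  have a2 : 0 < 2 * t - 1 + Real.exp (-t) ^ 2 := by linarith
  have a3 : 0 < t - 1 + Real.exp (-t) := by linarith
  intro j hj
  fin_cases hj
  · show 0 < diffCoeff (coeff32 1 (1 / 2)) 2 1 _
    rw [e1]; positivity
  · show 0 < diffCoeff (coeff32 1 (1 / 2)) 3 2 _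
    rw [e2]; positivity
  · show 0 < diffCoeff (coeff32 1 (1 / 2)) 4 3 _
    rw [e3]; positivity

/-! ### The quadratic form of the differentiation matrix -/

/-- The quadratic form `∑_{ℓ ≤ k ≤ s} d_{kℓ}(z) v_k v_ℓ` of the differentiation matrix, on real
sequences indexed from 1. -/
def lowerQuad (A : ℕ → ℕ → ℝ → ℝ) (s : ℕ) (z : ℝ) (v : ℕ → ℝ) : ℝ :=
  ∑ k ∈ Finset.Icc 1 s, v k * ∑ l ∈ Finset.Icc 1 k, diffEntry A k l z * v l

/-- With `A` the lower triangular matrix of difference coefficients and `v = Aᵀ w`, the congruence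
`D ↦ A D Aᵀ` replaces the kernels `θ` by `Aᵀ`, and the all-ones part by the square of the row sums
of `A`. -/
theorem lowerQuad_three_eq {A : ℕ → ℕ → ℝ → ℝ} {z : ℝ} {v : ℕ → ℝ}
    {w₁ w₂ w₃ a b c p q r : ℝ}
    (ha : diffCoeff A 2 1 z = a) (hb : diffCoeff A 3 2 z = b) (hc : diffCoeff A 4 3 z = c)
    (hp : diffCoeff A 3 1 z = p) (hq : diffCoeff A 4 2 z = q) (hr : diffCoeff A 4 1 z = r)
    (ha0 : a ≠ 0) (hb0 : b ≠ 0) (hc0 : c ≠ 0)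
    (hv₁ : v 1 = a * w₁ + p * w₂ + r * w₃) (hv₂ : v 2 = b * w₂ + q * w₃) (hv₃ : v 3 = c * w₃) :
    lowerQuad A 3 z v = a * w₁ ^ 2 + b * w₂ ^ 2 + c * w₃ ^ 2 + p * w₁ * w₂ + q * w₂ * w₃ +
      r * w₁ * w₃ + z / 2 * (a * w₁ + (p + b) * w₂ + (r + q + c) * w₃) ^ 2 := by
  have h1 : diffCoeff A (1 + 1) 1 z ≠ 0 := by simpa [ha] using ha0
  have h2 : diffCoeff A (2 + 1) 2 z ≠ 0 := by simpa [hb] using hb0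
  have h21 := sum_docKernel_mul_diffCoeff (show 1 ≤ 2 by norm_num) h1
  have h31 := sum_docKernel_mul_diffCoeff (show 1 ≤ 3 by norm_num) h1
  have h32 := sum_docKernel_mul_diffCoeff (show 2 ≤ 3 by norm_num) h2
  have θ₁₁ := docKernel_self A 1 z
  have θ₂₂ := docKernel_self A 2 z
  have θ₃₃ := docKernel_self A 3 z
  simp only [Nat.reduceAdd, ha, hb, hc] at θ₁₁ θ₂₂ θ₃₃
  simp [Finset.sum_Icc_succ_top, ha, hb, hp, hq, hr, θ₂₂, θ₃₃] at h21 h31 h32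
  have θ₃₂ : docKernel A 3 2 z = -(q / (b * c)) := by
    field_simp at h32 ⊢
    linear_combination h32
  have θ₂₁ : docKernel A 2 1 z = -(p / (a * b)) := by
    field_simp at h21 ⊢
    linear_combination h21
  have θ₃₁ : docKernel A 3 1 z = (p * q - r * b) / (a * b * c) := by
    rw [θ₃₂] at h31
    field_simp at h31 ⊢
    linear_combination h31
  simp [lowerQuad, diffEntry, Finset.sum_Icc_succ_top, θ₁₁, θ₂₂, θ₃₃, θ₂₁, θ₃₁, θ₃₂, hv₁, hv₂,
    hv₃]
  field_simp
  ring

theorem lowerQuad_pos {z : ℝ} (hz : z < 0) {v : ℕ → ℝ} (hv : v 1 ≠ 0 ∨ v 2 ≠ 0 ∨ v 3 ≠ 0) :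
    0 < lowerQuad (coeff32 1 (1 / 2)) 3 z v := by
  have hpos := diffCoeff_coeff32_diag_pos hz
  have ha0 := (hpos 1 (by simp)).ne'
  have hb0 := (hpos 2 (by simp)).ne'
  have hc0 := (hpos 3 (by simp)).ne'
  obtain ⟨t, rfl⟩ : ∃ t, z = -(2 * t) := ⟨-z / 2, by ring⟩
  have ht : 0 < t := by linarith
  obtain ⟨h, hh⟩ : ∃ h, h = Real.exp (-t) := ⟨_, rfl⟩
  obtain ⟨ea, eb, ec, ep, eq, er⟩ := diffCoeff_coeff32_values ht hh
  -- Solve `v = Aᵀ w` by back substitution.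
  obtain ⟨w₃, hw₃⟩ : ∃ w₃, v 3 = diffCoeff (coeff32 1 (1 / 2)) 4 3 (-(2 * t)) * w₃ :=
    ⟨_, (mul_div_cancel₀ _ hc0).symm⟩
  obtain ⟨w₂, hw₂⟩ : ∃ w₂, v 2 = diffCoeff (coeff32 1 (1 / 2)) 3 2 (-(2 * t)) * w₂ +
      diffCoeff (coeff32 1 (1 / 2)) 4 2 (-(2 * t)) * w₃ :=
    ⟨(v 2 - diffCoeff (coeff32 1 (1 / 2)) 4 2 (-(2 * t)) * w₃) / _, by
      rw [mul_div_cancel₀ _ hb0]; ring⟩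
  obtain ⟨w₁, hw₁⟩ : ∃ w₁, v 1 = diffCoeff (coeff32 1 (1 / 2)) 2 1 (-(2 * t)) * w₁ +
      diffCoeff (coeff32 1 (1 / 2)) 3 1 (-(2 * t)) * w₂ +
      diffCoeff (coeff32 1 (1 / 2)) 4 1 (-(2 * t)) * w₃ :=
    ⟨(v 1 - diffCoeff (coeff32 1 (1 / 2)) 3 1 (-(2 * t)) * w₂ -
      diffCoeff (coeff32 1 (1 / 2)) 4 1 (-(2 * t)) * w₃) / _, by
      rw [mul_div_cancel₀ _ ha0]; ring⟩
  -- The basis `e₁, e₂ + e₃, e₃` makes the entries short: the last two row sums of `A` are opposite,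
  -- so that the square of the row sums does not see `e₂ + e₃`.
  have hw : w₁ ≠ 0 ∨ w₂ ≠ 0 ∨ w₃ - w₂ ≠ 0 := by
    by_contra! hw
    obtain ⟨h1, h2, h3⟩ := hw
    have h3' : w₃ = 0 := by linarith
    simp [hw₁, hw₂, hw₃, h1, h2, h3'] at hv
  have hh0 : 0 < h := hh ▸ Real.exp_pos _
  have hh1 : h < 1 := hh ▸ Real.exp_lt_one_iff.mpr (by linarith)
  have hq := ternary_quadratic_pos (by
      have := pow_lt_one₀ hh0.le hh1 (n := 4) (by norm_num)
      have : 0 < 1 - h ^ 4 := by linarith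
      positivity) (minor_reducedForm_pos ht hh)
    (det_reducedForm_pos ht hh rfl rfl rfl rfl rfl rfl) hw
  -- The factor `8 * t ^ 2 = 2 * z ^ 2` clears the denominators of the coefficients.
  refine pos_of_mul_pos_right (a := 8 * t ^ 2) ?_ (by positivity)
  rw [lowerQuad_three_eq ea eb ec ep eq er (ea ▸ ha0) (eb ▸ hb0) (ec ▸ hc0)
    (by rw [hw₁, ea, ep, er]) (by rw [hw₂, eb, eq]) (by rw [hw₃, ec])]
  refine hq.trans_eq ?_
  field_simp
  ring

/-- Truncating the form to the first `j` stages amounts to setting the later entries to `0`. -/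
theorem lowerQuad_nonneg {z : ℝ} (hz : z < 0) (v : ℕ → ℝ) {j : ℕ} (hj : j ≤ 3) :
    0 ≤ lowerQuad (coeff32 1 (1 / 2)) j z v := by
  set v' : ℕ → ℝ := fun k => if k ≤ j then v k else 0 with hv'
  have htrunc : lowerQuad (coeff32 1 (1 / 2)) j z v = lowerQuad (coeff32 1 (1 / 2)) 3 z v' := by
    refine Finset.sum_subset_zero_on_sdiff (Finset.Icc_subset_Icc_right hj) ?_ ?_
    · intro k hk
      have : ¬ k ≤ j := by simp only [Finset.mem_sdiff, Finset.mem_Icc] at hk; omega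
      simp [hv', this]
    · intro k hk
      have hkj := (Finset.mem_Icc.mp hk).2
      simp only [hv', if_pos hkj]
      congr 1
      refine Finset.sum_congr rfl fun l hl => ?_
      rw [if_pos ((Finset.mem_Icc.mp hl).2.trans hkj)]
  rw [htrunc]
  by_cases hne : v' 1 ≠ 0 ∨ v' 2 ≠ 0 ∨ v' 3 ≠ 0
  · exact (lowerQuad_pos hz hne).le
  · push Not at hne
    simp [lowerQuad, Finset.sum_Icc_succ_top, hne]

theorem symPart_diffMatrix_posDef {z : ℝ} (hz : z < 0) :
    (symPart (diffMatrix 3 (coeff32 1 (1 / 2)) z)).PosDef := by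
  refine Matrix.PosDef.of_dotProduct_mulVec_pos ?_ fun x hx => ?_
  · ext i j
    simp [symPart]
    ring
  · have hne : x 0 ≠ 0 ∨ x 1 ≠ 0 ∨ x 2 ≠ 0 := by
      by_contra! h
      exact hx (by ext i; fin_cases i <;> simp [h])
    have hpos := lowerQuad_pos hz 
      (v := fun k => if k = 1 then x 0 else if k = 2 then x 1 else x 2) (by simpa using hne)
    refine hpos.trans_eq ?_
    simp [lowerQuad, symPart, diffMatrix, dotProduct, Matrix.mulVec, Fin.sum_univ_three,
      Finset.sum_Icc_succ_top, diffEntry]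
    ring

/-! ### Functional calculus in the eigenbasis -/

theorem _root_.Matrix.IsHermitian.inner_eigenvectorBasis_cfc {ι : Type*} [Fintype ι]
    [DecidableEq ι] {H : Matrix ι ι ℝ} (hH : H.IsHermitian) (f : ℝ → ℝ) (i : ι)
    (v : EuclideanSpace ℝ ι) :
    inner ℝ (hH.eigenvectorBasis i) (Matrix.toEuclideanLin (cfc f H) v) =
      f (hH.eigenvalues i) * inner ℝ (hH.eigenvectorBasis i) v := by
  have hself : (cfc f H).IsHermitian := (cfc_predicate f H : IsSelfAdjoint _)
  have heig : Matrix.toEuclideanLin (cfc f H) (hH.eigenvectorBasis i) =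
      f (hH.eigenvalues i) • hH.eigenvectorBasis i := by
    apply WithLp.ofLp_injective
    rw [Matrix.ofLp_toLpLin, Matrix.toLin'_apply, hH.cfc_eq, Matrix.IsHermitian.cfc,
      Unitary.conjStarAlgAut_apply, ← Matrix.mulVec_mulVec, ← Matrix.mulVec_mulVec,
      hH.star_eigenvectorUnitary_mulVec, Matrix.diagonal_mulVec_single]
    simp only [Function.comp_apply, RCLike.ofReal_real_eq_id, id, mul_one]
    have hsingle : Pi.single i (f (hH.eigenvalues i)) =
        f (hH.eigenvalues i) • (Pi.single i 1 : ι → ℝ) := by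
      ext j; simp [Pi.single_apply]
    rw [hsingle, Matrix.mulVec_smul, hH.eigenvectorUnitary_mulVec]
    rfl
  rw [← (Matrix.isSymmetric_toEuclideanLin_iff.mpr hself) _ v, heig, real_inner_smul_left]

/-! ### Energy inequality between consecutive stages -/

/-- The descent inequality, with constant `lg` in place of the sharp `lg / 2`: the mean value theorem
along the segment from `v` to `w` is enough for it. -/
theorem sub_le_of_lipschitz_neg_gradient {E : Type*} [NormedAddCommGroup E]
    [InnerProductSpace ℝ E] [CompleteSpace E] {Φ : E → ℝ} {g : E → E}
    (hgrad : ∀ v, HasGradientAt Φ (-g v) v) {lg : ℝ} (hlg : 0 ≤ lg)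
    (hLip : ∀ v w, ‖g v - g w‖ ≤ lg * ‖v - w‖) (v w : E) :
    Φ w - Φ v ≤ -inner ℝ (w - v) (g v) + lg * ‖w - v‖ ^ 2 := by
  have hderiv (s : ℝ) : HasDerivAt (fun s : ℝ => Φ (v + s • (w - v)))
      (inner ℝ (-g (v + s • (w - v))) (w - v)) s := by
    have h1 : HasDerivAt (fun s : ℝ => v + s • (w - v)) (w - v) s := by
      simpa using ((hasDerivAt_id s).smul_const (w - v)).const_add v
    exact (hgrad (v + s • (w - v))).hasFDerivAt.comp_hasDerivAt s h1
  obtain ⟨s, hs, hmean⟩ := exists_hasDerivAt_eq_slope (fun s : ℝ => Φ (v + s • (w - v))) _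
    zero_lt_one (fun s _ => (hderiv s).continuousAt.continuousWithinAt) fun s _ => hderiv s
  have hval : Φ w - Φ v = -inner ℝ (w - v) (g v) +
      inner ℝ (g v - g (v + s • (w - v))) (w - v) := by
    simp only [one_smul, zero_smul, add_zero, sub_zero, div_one, add_sub_cancel] at hmean
    rw [← hmean, inner_sub_left (g v), inner_neg_left,
      real_inner_comm (g v) (w - v)]
    ring
  have hbound : inner ℝ (g v - g (v + s • (w - v))) (w - v) ≤ lg * ‖w - v‖ ^ 2 := by
    refine (real_inner_le_norm _ _).trans ?_
    have h1 := hLip v (v + s • (w - v))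
    have h2 : ‖v - (v + s • (w - v))‖ ≤ ‖w - v‖ := by
      rw [sub_add_cancel_left, norm_neg, norm_smul, Real.norm_of_nonneg hs.1.le]
      exact mul_le_of_le_one_left (norm_nonneg _) hs.2.le
    nlinarith [norm_nonneg (w - v), mul_le_mul_of_nonneg_left h2 hlg]
  linarith

/-- The energy inequality between two consecutive stages: half of the stabilization `κ` absorbs the
defect `lg * ‖w - v‖ ^ 2` of the descent inequality. -/
theorem energy_sub_le {ι : Type*} [Fintype ι] [DecidableEq ι] {L : Matrix ι ι ℝ}
    (hL : L.IsHermitian) {g G : EuclideanSpace ℝ ι → EuclideanSpace ℝ ι}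
    (hgrad : ∀ v, HasGradientAt (fun w => ∑ i, G w i) (-g v) v)
    {lg : ℝ} (hlg : 0 ≤ lg) (hLip : ∀ v w, ‖g v - g w‖ ≤ lg * ‖v - w‖)
    {κ : ℝ} (hκ : 2 * lg ≤ κ) (v w : EuclideanSpace ℝ ι) :
    energy L G w - energy L G v ≤ -inner ℝ (w - v)
      (gstab g κ v - (1 / 2 : ℝ) • Matrix.toEuclideanLin (Lstab L κ) (w + v)) := by
  have hpot := sub_le_of_lipschitz_neg_gradient hgrad hlg hLip v w
  have hsymm : inner ℝ v (Matrix.toEuclideanLin L w) = inner ℝ w (Matrix.toEuclideanLin L v) := by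
    rw [real_inner_comm]
    exact (Matrix.isSymmetric_toEuclideanLin_iff.mpr hL) w v
  have hstab : Matrix.toEuclideanLin (Lstab L κ) (w + v) =
      Matrix.toEuclideanLin L w + Matrix.toEuclideanLin L v + κ • (w + v) := by
    simp [Lstab, map_add, Matrix.toLpLin_one]
    abel
  have hnorm : ‖w - v‖ ^ 2 = inner ℝ w w - 2 * inner ℝ w v + inner ℝ v v := by
    rw [norm_sub_sq_real, real_inner_self_eq_norm_sq, real_inner_self_eq_norm_sq]
  have hκ' : lg * ‖w - v‖ ^ 2 ≤ κ / 2 * ‖w - v‖ ^ 2 := by gcongr; linarith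
  rw [hnorm] at hκ'
  have hcomm : inner ℝ v w = inner ℝ w v := real_inner_comm w v
  rw [hstab, energy, energy, gstab]
  rw [hnorm] at hpot
  simp only [inner_sub_left, inner_sub_right, inner_add_right, inner_smul_right] at hpot ⊢
  rw [hsymm, hcomm]
  linarith

/-! ### Spectral reduction of one step -/

section Step

theorem neg_smul_Lstab_isHermitian {ι : Type*} [DecidableEq ι] {L : Matrix ι ι ℝ}
    (hL : L.IsHermitian) (κ τ : ℝ) :
    (-(τ • Lstab L κ)).IsHermitian := by
  have h1 : (κ • (1 : Matrix ι ι ℝ)).IsHermitian := by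
    simp [Matrix.IsHermitian]
  have h2 : (τ • (L + κ • (1 : Matrix ι ι ℝ))).IsHermitian := by
    have := hL.add h1
    rw [Matrix.IsHermitian] at this ⊢
    rw [Matrix.conjTranspose_smul, this, star_trivial]
  exact h2.neg

variable {ι : Type*} [Fintype ι] [DecidableEq ι] {L : Matrix ι ι ℝ} {κ τ : ℝ}

theorem neg_smul_Lstab_eigenvalues_neg (hL : L.PosDef) (hκ : 0 ≤ κ) (hτ : 0 < τ) (i : ι) :
    (neg_smul_Lstab_isHermitian hL.1 κ τ).eigenvalues i < 0 := by
  have hpd : (τ • Lstab L κ).PosDef :=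
    (hL.add_posSemidef (Matrix.PosSemidef.one.smul hκ)).smul hτ
  set hH := neg_smul_Lstab_isHermitian hL.1 κ τ
  have hne : (hH.eigenvectorBasis i).ofLp ≠ 0 := fun h =>
    hH.eigenvectorBasis.orthonormal.ne_zero i (WithLp.ofLp_injective _ h)
  have hpos := hpd.dotProduct_mulVec_pos hne
  rw [hH.eigenvalues_eq i, Matrix.neg_mulVec, dotProduct_neg]
  simpa using hpos

theorem inner_eigenvectorBasis_applyFun (hL : L.IsHermitian) (f : ℝ → ℝ) (i : ι)
    (v : EuclideanSpace ℝ ι) :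
    inner ℝ ((neg_smul_Lstab_isHermitian hL κ τ).eigenvectorBasis i) (applyFun f L κ τ v) =
      f ((neg_smul_Lstab_isHermitian hL κ τ).eigenvalues i) *
        inner ℝ ((neg_smul_Lstab_isHermitian hL κ τ).eigenvectorBasis i) v :=
  (neg_smul_Lstab_isHermitian hL κ τ).inner_eigenvectorBasis_cfc f i v

theorem inner_eigenvectorBasis_smul_Lstab (hL : L.IsHermitian) (i : ι)
    (v : EuclideanSpace ℝ ι) :
    τ * inner ℝ ((neg_smul_Lstab_isHermitian hL κ τ).eigenvectorBasis i)
        (Matrix.toEuclideanLin (Lstab L κ) v) =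
      -((neg_smul_Lstab_isHermitian hL κ τ).eigenvalues i *
        inner ℝ ((neg_smul_Lstab_isHermitian hL κ τ).eigenvectorBasis i) v) := by
  have h := (neg_smul_Lstab_isHermitian hL κ τ).inner_eigenvectorBasis_cfc id i v
  have hid : cfc (id : ℝ → ℝ) (-(τ • Lstab L κ)) = -(τ • Lstab L κ) :=
    cfc_id ℝ _ (neg_smul_Lstab_isHermitian hL κ τ)
  rw [hid, id] at h
  rw [← h]
  simp [inner_smul_right]

variable {s : ℕ} {a : ℕ → ℕ → ℝ → ℝ} {g G : EuclideanSpace ℝ ι → EuclideanSpace ℝ ι}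
  {v w : EuclideanSpace ℝ ι} {U : ℕ → EuclideanSpace ℝ ι}

/-- In the eigenbasis of `-τ L_κ` this is `sum_diffEntry_mul_stage_diff` at each eigenvalue. -/
theorem IsStep.sum_applyFun_diffEntry (hstep : IsStep s a L g κ τ v U w) (hL : L.PosDef)
    (hκ : 0 ≤ κ) (hτ : 0 < τ)
    (ha : ∀ z < 0, ∀ j ∈ Finset.Icc 1 s, diffCoeff a (j + 1) j z ≠ 0)
    {k : ℕ} (hk : k ∈ Finset.Icc 1 s) :
    ∑ l ∈ Finset.Icc 1 k, applyFun (diffEntry a k l) L κ τ (U (l + 1) - U l) =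
      τ • (gstab g κ (U k) -
        (1 / 2 : ℝ) • Matrix.toEuclideanLin (Lstab L κ) (U (k + 1) + U k)) := by
  set hH := neg_smul_Lstab_isHermitian hL.1 κ τ with hH_def
  refine InnerProductSpace.ext_inner_left_basis hH.eigenvectorBasis.toBasis fun i => ?_
  rw [OrthonormalBasis.coe_toBasis]
  have hcoord := sum_diffEntry_mul_stage_diff (a := a) (z := hH.eigenvalues i)
    (x := fun k => inner ℝ (hH.eigenvectorBasis i) (U k))
    (F := fun j => inner ℝ (hH.eigenvectorBasis i)
      (τ • gstab g κ (U j) - τ • Matrix.toEuclideanLin (Lstab L κ) (U 1)))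
    (ha _ (neg_smul_Lstab_eigenvalues_neg hL hκ hτ i))
    (fun m hm => by
      rw [hstep.2.1 m hm, inner_add_right, inner_sum]
      congr 1
      exact Finset.sum_congr rfl fun j _ => inner_eigenvectorBasis_applyFun hL.1 _ i _) hk
  have hlhs : inner ℝ (hH.eigenvectorBasis i)
      (∑ l ∈ Finset.Icc 1 k, applyFun (diffEntry a k l) L κ τ (U (l + 1) - U l)) =
      ∑ l ∈ Finset.Icc 1 k, diffEntry a k l (hH.eigenvalues i) *
        (inner ℝ (hH.eigenvectorBasis i) (U (l + 1)) - inner ℝ (hH.eigenvectorBasis i) (U l)) := by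
    rw [inner_sum]
    refine Finset.sum_congr rfl fun l _ => ?_
    rw [← inner_sub_right]
    exact inner_eigenvectorBasis_applyFun hL.1 _ i _
  rw [hlhs, hcoord]
  have h1 := inner_eigenvectorBasis_smul_Lstab (κ := κ) (τ := τ) hL.1 i (U 1)
  have h2 := inner_eigenvectorBasis_smul_Lstab (κ := κ) (τ := τ) hL.1 i (U (k + 1) + U k)
  rw [← hH_def] at h1 h2
  rw [inner_add_right] at h2
  simp only [inner_sub_right, inner_smul_right]
  linear_combination -h1 + h2 / 2

/-- The functional calculus diagonalizes the dissipation into one copy of `lowerQuad` for each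
eigenvalue of `-τ L_κ`. -/
theorem dissipation_nonneg (hL : L.PosDef) (hκ : 0 ≤ κ) (hτ : 0 < τ) {j : ℕ}
    (hquad : ∀ z < 0, ∀ x : ℕ → ℝ, 0 ≤ lowerQuad a j z x) (U : ℕ → EuclideanSpace ℝ ι) :
    0 ≤ dissipation a L κ τ U j := by
  set hH := neg_smul_Lstab_isHermitian hL.1 κ τ with hH_def
  have hspec : dissipation a L κ τ U j = ∑ i, lowerQuad a j (hH.eigenvalues i)
      (fun k => inner ℝ (hH.eigenvectorBasis i) (U (k + 1) - U k)) := by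
    simp only [dissipation, lowerQuad]
    rw [Finset.sum_comm]
    refine Finset.sum_congr rfl fun k _ => ?_
    rw [← hH.eigenvectorBasis.sum_inner_mul_inner]
    refine Finset.sum_congr rfl fun i _ => ?_
    rw [real_inner_comm, inner_sum]
    congr 1
    exact Finset.sum_congr rfl fun l _ => inner_eigenvectorBasis_applyFun hL.1 _ i _
  rw [hspec]
  exact Finset.sum_nonneg fun i _ => hquad _ (neg_smul_Lstab_eigenvalues_neg hL hκ hτ i) _

theorem IsStep.energy_sub_le_dissipation (hstep : IsStep s a L g κ τ v U w) (hL : L.PosDef)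
    (hgrad : ∀ v, HasGradientAt (fun w => ∑ i, G w i) (-g v) v)
    {lg : ℝ} (hlg : 0 ≤ lg) (hLip : ∀ v w, ‖g v - g w‖ ≤ lg * ‖v - w‖)
    (hκ : 2 * lg ≤ κ) (hτ : 0 < τ)
    (ha : ∀ z < 0, ∀ j ∈ Finset.Icc 1 s, diffCoeff a (j + 1) j z ≠ 0)
    {j : ℕ} (hj : j ≤ s) :
    energy L G (U (j + 1)) - energy L G (U 1) ≤ -(1 / τ) * dissipation a L κ τ U j := by
  have htel : ∑ k ∈ Finset.Icc 1 j, (energy L G (U (k + 1)) - energy L G (U k)) =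
      energy L G (U (j + 1)) - energy L G (U 1) := by
    rw [← Finset.Ico_add_one_right_eq_Icc,
      Finset.sum_Ico_sub (fun k => energy L G (U k)) (by omega)]
  rw [← htel, dissipation, Finset.mul_sum]
  refine Finset.sum_le_sum fun k hk => ?_
  have hks : k ∈ Finset.Icc 1 s := Finset.Icc_subset_Icc_right hj hk
  rw [hstep.sum_applyFun_diffEntry hL (by linarith) hτ ha hks, inner_smul_right]
  refine (energy_sub_le hL.1 hgrad hlg hLip hκ (U k) (U (k + 1))).trans_eq ?_
  field_simp

end Step

end EERK

end

theorem mainTheorem7 :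
    (∀ z : ℝ, z < 0 →
      (EERK.symPart (EERK.diffMatrix 3 (EERK.coeff32 1 (1 / 2)) z)).PosDef) ∧
    (∀ {ι : Type*} [Fintype ι] [DecidableEq ι]
      (L : Matrix ι ι ℝ) (_hL : L.PosDef)
      (g G : EuclideanSpace ℝ ι → EuclideanSpace ℝ ι)
      (_hGnonneg : ∀ v i, 0 ≤ G v i)
      (_hgrad : ∀ v, HasGradientAt (fun w => ∑ i, G w i) (-g v) v)
      (lg : ℝ) (_hlg : 0 < lg) (_hLip : ∀ v w, ‖g v - g w‖ ≤ lg * ‖v - w‖)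
      (κ : ℝ) (_hκ : 2 * lg ≤ κ)
      (N : ℕ) (τ : ℕ → ℝ) (_hτ : ∀ n ∈ Finset.Icc 1 N, 0 < τ n)
      (u : ℕ → EuclideanSpace ℝ ι) (U : ℕ → ℕ → EuclideanSpace ℝ ι)
      (_hstep : ∀ n ∈ Finset.Icc 1 N,
        EERK.IsStep 3 (EERK.coeff32 1 (1 / 2)) L g κ (τ n) (u (n - 1)) (U n) (u n)),
      ∀ n ∈ Finset.Icc 1 N,
        (∀ j ∈ Finset.Icc 1 3,
          EERK.energy L G (U n (j + 1)) - EERK.energy L G (U n 1)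
              ≤ -(1 / τ n)
                * EERK.dissipation (EERK.coeff32 1 (1 / 2)) L κ (τ n) (U n) j ∧
          0 ≤ EERK.dissipation (EERK.coeff32 1 (1 / 2)) L κ (τ n) (U n) j ∧
          EERK.energy L G (U n (j + 1)) ≤ EERK.energy L G (U n 1)) ∧
        EERK.energy L G (u n) ≤ EERK.energy L G (u (n - 1))) := by
  refine ⟨fun z hz => EERK.symPart_diffMatrix_posDef hz, ?_⟩
  intro ι _ _ L hL g G _ hgrad lg hlg hLip κ hκ N τ hτ u U hstep n hn
  have hκ0 : 0 ≤ κ := by linarith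
  have hstage (j : ℕ) (hj : j ≤ 3) := (hstep n hn).energy_sub_le_dissipation hL hgrad hlg.le hLip hκ
    (hτ n hn) (fun z hz j hj => (EERK.diffCoeff_coeff32_diag_pos hz j hj).ne') hj
  have hdiss (j : ℕ) (hj : j ≤ 3) := EERK.dissipation_nonneg hL hκ0 (hτ n hn)
    (fun z hz x => EERK.lowerQuad_nonneg hz x hj) (U n)
  have hdecay (j : ℕ) (hj : j ≤ 3) : EERK.energy L G (U n (j + 1)) ≤ EERK.energy L G (U n 1) := by
    have hinv : 0 ≤ 1 / τ n := one_div_nonneg.mpr (hτ n hn).le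
    have := mul_nonneg hinv (hdiss j hj)
    linarith [hstage j hj]
  refine ⟨fun j hj => ?_, ?_⟩
  · have hj3 := (Finset.mem_Icc.mp hj).2
    exact ⟨hstage j hj3, hdiss j hj3, hdecay j hj3⟩
  · rw [(hstep n hn).2.2, ← (hstep n hn).1]
    exact hdecay 3 le_rfl
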